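/- Let $n\ge 1$ and $-\infty<\alpha<\beta<\infty$. Let $\varphi_{n,0}\equiv 1,\varphi_{n,1},\dots,\varphi_{n,n}\in C^n([\alpha,\beta])$ be an extended Chebyshev (EC) system on $[\alpha,\beta]$: for all $0\le r\le n$, all knots $\alpha\le u_0<\dots<u_r\le\beta$, all integers $m_k\ge 1$ with $\sum_{k=0}^r m_k=n+1$ and all real $\xi_{k,\ell}$, there is exactly one $f=\sum_{i=0}^n\lambda_{n,i}\varphi_{n,i}$ $(\lambda_{n,i}\in\mathbb R)$ with $f^{(\ell)}(u_k)=\xi_{k,\ell}$ for $0\le k\le r$, $0\le\ell\le m_k-1$. Let $b_{n,0},\dots,b_{n,n}$ be the normalized B-basis of $\operatorname{span}\{\varphi_{n,0},\dots,\varphi_{n,n}\}$, that is, a basis of this space consisting of non-negative functions on $[\alpha,\beta]$ with $\sum_{i=0}^n b_{n,i}\equiv 1$, $b_{n,0}(\alpha)=b_{n,n}(\beta)=1$, and, for $0\le i\le n$, $$b_{n,i}^{(j)}(\alpha)=0\ (0\le j\le i-1),\quad b_{n,i}^{(i)}(\alpha)>0,\qquad b_{n,i}^{(j)}(\beta)=0\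 (0\le j\le n-1-i),\quad (-1)^{n-i}b_{n,i}^{(n-i)}(\beta)>0$$ (it is assumed that such a basis exists). Define the matrix $[t^n_{i,j}]_{i,j=0}^n$ by $t^n_{0,j}=1$ for $0\le j\le n$, by $t^n_{i,0}=\varphi_{n,i}(\alpha)$ and $t^n_{i,n}=\varphi_{n,i}(\beta)$ for $0\le i\le n$, and, for $1\le i\le n$ and $1\le j\le\lfloor n/2\rfloor$, by $$t^n_{i,j}=\varphi_{n,i}(\alpha)-\frac{1}{b_{n,j}^{(j)}(\alpha)}\sum_{r=1}^{j-1}\frac{\varphi_{n,i}^{(r)}(\alpha)}{b_{n,r}^{(r)}(\alpha)}\Bigg(b_{n,r}^{(j)}(\alpha)+\sum_{\ell=1}^{j-r-1}(-1)^\ell\sum_{r<k_1<\dots<k_\ell<j}\frac{b_{n,r}^{(k_1)}(\alpha)\,b_{n,k_1}^{(k_2)}(\alpha)\cdots b_{n,k_{\ell-1}}^{(k_\ell)}(\alpha)\,b_{n,k_\ell}^{(j)}(\alpha)}{b_{n,k_1}^{(k_1)}(\alpha)\cdots b_{n,k_\ell}^{(k_\ell)}(\alpha)}\Bigg)+\frac{\varphi_{n,i}^{(j)}(\alpha)}{b_{n,j}^{(j)}(\alpha)},$$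 $$t^n_{i,n-j}=\varphi_{n,i}(\beta)-\frac{1}{b_{n,n-j}^{(j)}(\beta)}\sum_{r=1}^{j-1}\frac{\varphi_{n,i}^{(r)}(\beta)}{b_{n,n-r}^{(r)}(\beta)}\Bigg(b_{n,n-r}^{(j)}(\beta)+\sum_{\ell=1}^{j-r-1}(-1)^\ell\sum_{r<k_1<\dots<k_\ell<j}\frac{b_{n,n-r}^{(k_1)}(\beta)\,b_{n,n-k_1}^{(k_2)}(\beta)\cdots b_{n,n-k_{\ell-1}}^{(k_\ell)}(\beta)\,b_{n,n-k_\ell}^{(j)}(\beta)}{b_{n,n-k_1}^{(k_1)}(\beta)\cdots b_{n,n-k_\ell}^{(k_\ell)}(\beta)}\Bigg)+\frac{\varphi_{n,i}^{(j)}(\beta)}{b_{n,n-j}^{(j)}(\beta)}.$$ For even $n$ the two formulas for the middle column $j=n/2$ give the same value, so that the matrix is well defined. Let $\delta\ge 2$ and $\boldsymbol\lambda_0,\dots,\boldsymbol\lambda_n\in\mathbb R^\delta$, $\boldsymbol\lambda_i=[\lambda_i^\ell]_{\ell=1}^\delta$. Then the ordinary integral curve $\mathbf c(u)=\sum_{i=0}^n\boldsymbol\lambda_i\varphi_{n,i}(u)$,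 $u\in[\alpha,\beta]$, of order $n$ is an EC B-curve of the same order: $$\mathbf c(u)=\sum_{j=0}^n\mathbf p_j\,b_{n,j}(u)\quad\text{for all }u\in[\alpha,\beta],\qquad \mathbf p_j=[p_j^\ell]_{\ell=1}^\delta\in\mathbb R^\delta,\quad p_j^\ell=\sum_{i=0}^n\lambda_i^\ell\,t^n_{i,j}.$$ -/

import Mathlib

open Set

noncomputable section

namespace ECCurve

/-- The `k`-th derivative of `f` on the interval `[α, β]` at the point `x`
(one-sided at the end points). -/
def dI (α β : ℝ) (k : ℕ) (f : ℝ → ℝ) (x : ℝ) : ℝ :=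
  iteratedDerivWithin k f (Icc α β) x

/-- `φ 0, …, φ n` is an extended Chebyshev (EC) system on `[α, β]`: the functions are of class
`C^n` there, and every Hermite interpolation problem with `r + 1` knots (`0 ≤ r ≤ n`) and
positive multiplicities adding up to `n + 1` has exactly one solution `∑ i, lam i * φ i`. -/
structure IsECSystem (n : ℕ) (α β : ℝ) (φ : Fin (n + 1) → ℝ → ℝ) : Prop where
  contDiffOn : ∀ i, ContDiffOn ℝ (n : WithTop ℕ∞) (φ i) (Icc α β)
  hermite : ∀ r : ℕ, r ≤ n → ∀ u : Fin (r + 1) → ℝ, StrictMono u → (∀ k, u k ∈ Icc α β) →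
    ∀ m : Fin (r + 1) → ℕ, (∀ k, 1 ≤ m k) → ∑ k, m k = n + 1 →
    ∀ ξ : Fin (r + 1) → ℕ → ℝ,
    ∃! lam : Fin (n + 1) → ℝ, ∀ k, ∀ l < m k,
      dI α β l (fun x => ∑ i, lam i * φ i x) (u k) = ξ k l

/-- The linear span of a family of functions, as functions on `[α, β]`. -/
def spanOn {n : ℕ} (α β : ℝ) (φ : Fin (n + 1) → ℝ → ℝ) : Submodule ℝ (Icc α β → ℝ) :=
  Submodule.span ℝ (range fun i => (Icc α β).domRestrict (φ i))

/-- `b 0, …, b n` is a non-negative normalized B-basis on `[α, β]` of the space spanned by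
`φ 0, …, φ n`. -/
structure IsNormalizedBBasis (n : ℕ) (α β : ℝ) (φ b : Fin (n + 1) → ℝ → ℝ) : Prop where
  linearIndependent : LinearIndependent ℝ (fun j => (Icc α β).domRestrict (b j))
  span_eq : spanOn α β b = spanOn α β φ
  nonneg : ∀ j, ∀ u ∈ Icc α β, 0 ≤ b j u
  sum_eq_one : ∀ u ∈ Icc α β, ∑ j, b j u = 1
  left_end : b 0 α = 1
  right_end : b (Fin.last n) β = 1
  left_zero : ∀ i : Fin (n + 1), ∀ j < (i : ℕ), dI α β j (b i) α = 0
  left_pos : ∀ i : Fin (n + 1), 0 < dI α β i (b i) α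
  right_zero : ∀ i : Fin (n + 1), ∀ j < n - (i : ℕ), dI α β j (b i) β = 0
  right_pos : ∀ i : Fin (n + 1),
    0 < (-1 : ℝ) ^ (n - (i : ℕ)) * dI α β (n - (i : ℕ)) (b i) β

/-- The sum over all `r < k₁ < ⋯ < k_l < j` of
`(D r k₁ * D k₁ k₂ * ⋯ * D k_l j) / (D k₁ k₁ * ⋯ * D k_l k_l)`. -/
def chainSum {n : ℕ} (D : Fin (n + 1) → ℕ → ℝ) (r j : Fin (n + 1)) (l : ℕ) : ℝ :=
  open Classical in
  ∑ k : Fin l → Fin (n + 1) with StrictMono k ∧ ∀ a, r < k a ∧ k a < j,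
    (∏ a : Fin (l + 1), D ((Fin.cons r k : Fin (l + 1) → Fin (n + 1)) a)
        ((Fin.snoc k j : Fin (l + 1) → Fin (n + 1)) a : ℕ)) /
      ∏ a : Fin l, D (k a) (k a : ℕ)

/-- The common shape of the closed formulas for the entries of the transformation matrix:
`f r` is the `r`-th derivative of an ordinary basis function at an end point, and `D k r` the
`r`-th derivative there of the B-basis function of index `k`, counted from that end point. -/
def entryFormula {n : ℕ} (f : ℕ → ℝ) (D : Fin (n + 1) → ℕ → ℝ) (j : Fin (n + 1)) : ℝ :=
  f 0 - 1 / D j j * (∑ r ∈ Finset.Ioo 0 j, f r / D r r *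
      (D r j + ∑ l ∈ Finset.Icc 1 ((j : ℕ) - (r : ℕ) - 1), (-1 : ℝ) ^ l * chainSum D r j l))
    + f j / D j j

/-- The closed formula at `α`, giving the entry of column `j`, `1 ≤ j ≤ ⌊n / 2⌋`. -/
def leftEntry {n : ℕ} (α β : ℝ) (φ b : Fin (n + 1) → ℝ → ℝ) (i j : Fin (n + 1)) : ℝ :=
  entryFormula (fun r => dI α β r (φ i) α) (fun k r => dI α β r (b k) α) j

/-- The closed formula at `β`, giving the entry of column `n - j`, `1 ≤ j ≤ ⌊n / 2⌋`
(`k.rev` is `n - k`). -/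
def rightEntry {n : ℕ} (α β : ℝ) (φ b : Fin (n + 1) → ℝ → ℝ) (i j : Fin (n + 1)) : ℝ :=
  entryFormula (fun r => dI α β r (φ i) β) (fun k r => dI α β r (b k.rev) β) j

/-- The entries `t i j` of the transformation matrix. -/
def t {n : ℕ} (α β : ℝ) (φ b : Fin (n + 1) → ℝ → ℝ) (i j : Fin (n + 1)) : ℝ :=
  if i = 0 then 1
  else if j = 0 then φ i α
  else if j = Fin.last n then φ i β
  else if (j : ℕ) ≤ n / 2 then leftEntry α β φ b i j
  else rightEntry α β φ b i j.rev

end ECCurve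

end

namespace ECCurve

/-! ### Signed chain sums and forward substitution in a triangular system -/

section Chains

variable {n : ℕ} (D : Fin (n + 1) → ℕ → ℝ)

/-! The claim is that `t i j` is the `j`-th coefficient of `φ i` in the B-basis; the curve identity
then follows by exchanging two sums. Write `φ i = ∑ c k * b k` and differentiate at `α`. As `b k`
vanishes there to order exactly `k`, the system for `c` is triangular with non-zero diagonal. Since
the `b k` sum to 1, their derivatives of positive order sum to 0, so the system involves only the
differences `c k - c 0`, with `c 0 = φ i α`. Forward substitution expresses the solution through
signed sums over chains `r < k₁ < ⋯ < j`: the recursion `altChainSum_rec` is one substitution step,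
and `entryFormula_eq` carries it through. Reversing the indices gives the same at `β`, so for even
`n` both formulas yield the same middle coefficient. -/

theorem chainSum_zero (r j : Fin (n + 1)) : chainSum D r j 0 = D r j := by
  classical
  have h : ∀ k : Fin 0 → Fin (n + 1), StrictMono k ∧ ∀ a, r < k a ∧ k a < j :=
    fun k => ⟨fun a => a.elim0, fun a => a.elim0⟩
  simp [chainSum, h, Fin.snoc]

/-- A strictly increasing chain injects into `Ioo r j`, which is too small to hold `l` elements. -/
theorem chainSum_eq_zero {r j : Fin (n + 1)} {l : ℕ} (h : (j : ℕ) - (r : ℕ) - 1 < l) :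
    chainSum D r j l = 0 := by
  classical
  unfold chainSum
  refine Finset.sum_eq_zero fun k hk => ?_
  exfalso
  obtain ⟨hk, hk'⟩ := (Finset.mem_filter.1 hk).2
  have := Finset.card_le_card_of_injOn (s := Finset.univ) (t := Finset.Ioo r j) k
    (fun a _ => by simpa using hk' a) hk.injective.injOn
  rw [Fin.card_Ioo, Finset.card_univ, Fintype.card_fin] at this
  omega

theorem strictMono_snoc_between_iff {l : ℕ} {r j m : Fin (n + 1)} {k : Fin l → Fin (n + 1)} :
    (StrictMono (Fin.snoc k m : Fin (l + 1) → Fin (n + 1)) ∧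
      ∀ a, r < (Fin.snoc k m : Fin (l + 1) → Fin (n + 1)) a ∧
        (Fin.snoc k m : Fin (l + 1) → Fin (n + 1)) a < j) ↔
      m ∈ Finset.Ioo r j ∧ StrictMono k ∧ ∀ a, r < k a ∧ k a < m := by
  constructor
  · rintro ⟨h, h'⟩
    refine ⟨by simpa using h' (Fin.last l), fun a c hac => ?_, fun a => ⟨?_, ?_⟩⟩
    · simpa using h (Fin.castSucc_lt_castSucc_iff.2 hac)
    · simpa using (h' a.castSucc).1
    · simpa using h (Fin.castSucc_lt_last a)
  · rintro ⟨hm, h, h'⟩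
    rw [Finset.mem_Ioo] at hm
    refine ⟨fun a c hac => ?_, fun a => ?_⟩
    · induction c using Fin.lastCases with
      | last =>
        induction a using Fin.lastCases with
        | last => exact absurd hac (lt_irrefl _)
        | cast a => simpa using (h' a).2
      | cast c =>
        induction a using Fin.lastCases with
        | last => exact absurd (hac.trans (Fin.castSucc_lt_last c)) (lt_irrefl _)
        | cast a => simpa using h (Fin.castSucc_lt_castSucc_iff.1 hac)
    · induction a using Fin.lastCases with
      | last => simpa using hm
      | cast a => simpa using ⟨(h' a).1, (h' a).2.trans hm.2⟩

/-- Splitting a chain at its largest inner element. -/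
theorem chainSum_succ (r j : Fin (n + 1)) (l : ℕ) :
    chainSum D r j (l + 1) = ∑ m ∈ Finset.Ioo r j, chainSum D r m l / D m m * D m j := by
  classical
  unfold chainSum
  have hsnoc : ∀ (m : Fin (n + 1)) (k : Fin l → Fin (n + 1)),
      (Fin.snocEquiv fun _ : Fin (l + 1) => Fin (n + 1)) (m, k) = Fin.snoc k m := fun _ _ => rfl
  have hIoo : Finset.Ioo r j = Finset.univ.filter fun m => m ∈ Finset.Ioo r j := by
    ext m
    simp
  -- Each chain of length `l + 1` is a pair: its last element `m` and the remaining chain `k`.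
  rw [Finset.sum_filter, ← (Fin.snocEquiv fun _ : Fin (l + 1) => Fin (n + 1)).sum_comp,
    Fintype.sum_prod_type, hIoo, Finset.sum_filter]
  refine Finset.sum_congr rfl fun m _ => ?_
  by_cases hm : m ∈ Finset.Ioo r j
  · rw [if_pos hm, Finset.sum_filter, Finset.sum_div, Finset.sum_mul]
    refine Finset.sum_congr rfl fun k _ => ?_
    rw [hsnoc]
    by_cases hk : StrictMono k ∧ ∀ a, r < k a ∧ k a < m
    · rw [if_pos hk, if_pos (strictMono_snoc_between_iff.2 ⟨hm, hk⟩), Fin.cons_snoc_eq_snoc_cons,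
        Fin.prod_univ_castSucc (n := l + 1), Fin.prod_univ_castSucc (n := l)
          (f := fun a => D ((Fin.snoc k m : Fin (l + 1) → Fin (n + 1)) a) _)]
      simp only [Fin.snoc_castSucc, Fin.snoc_last]
      rw [div_div, div_mul_eq_mul_div]
    · rw [if_neg hk, if_neg fun h => hk (strictMono_snoc_between_iff.1 h).2, zero_div, zero_mul]
  · rw [if_neg hm]
    refine Finset.sum_eq_zero fun k _ => if_neg fun h => hm ?_
    rw [hsnoc] at h
    exact (strictMono_snoc_between_iff.1 h).1

/-- The signed sum over all chains from `r` to `j`. -/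
noncomputable def altChainSum (r j : Fin (n + 1)) : ℝ :=
  ∑ l ∈ Finset.range (n + 1), (-1 : ℝ) ^ l * chainSum D r j l

/-- The surplus terms vanish. A summation range independent of `r` and `j` lets sums over `l` and
over chain elements be exchanged. -/
theorem altChainSum_eq (r j : Fin (n + 1)) :
    D r j + ∑ l ∈ Finset.Icc 1 ((j : ℕ) - (r : ℕ) - 1), (-1 : ℝ) ^ l * chainSum D r j l =
      altChainSum D r j := by
  rw [altChainSum, Finset.sum_range_eq_add_Ico _ (Nat.succ_pos n), chainSum_zero, pow_zero, one_mul]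
  congr 1
  refine Finset.sum_subset (fun l hl => ?_) fun l hl hl' => ?_
  · rw [Finset.mem_Icc] at hl
    rw [Finset.mem_Ico]
    omega
  · rw [Finset.mem_Ico] at hl
    rw [Finset.mem_Icc] at hl'
    rw [chainSum_eq_zero D (by omega), mul_zero]

/-- Non-empty chains are grouped by their largest inner element `k`; removing it shortens the chain
by one and flips the sign. -/
theorem altChainSum_rec (r j : Fin (n + 1)) :
    altChainSum D r j =
      D r j - ∑ k ∈ Finset.Ioo r j, altChainSum D r k / D k k * D k j := by
  -- A vanishing term is appended so that splitting off `l = 0` leaves a shifted sum of full length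
  -- `n + 1`.
  have h : altChainSum D r j =
      ∑ l ∈ Finset.range (n + 2), (-1 : ℝ) ^ l * chainSum D r j l := by
    rw [Finset.sum_range_succ, chainSum_eq_zero D (l := n + 1) (by omega), mul_zero, add_zero,
      altChainSum]
  rw [h, Finset.sum_range_succ', chainSum_zero, pow_zero, one_mul, add_comm, sub_eq_add_neg,
    ← Finset.sum_neg_distrib]
  congr 1
  simp_rw [chainSum_succ, altChainSum, Finset.mul_sum, Finset.sum_div, Finset.sum_mul]
  rw [Finset.sum_comm]
  refine Finset.sum_congr rfl fun k _ => ?_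
  rw [← Finset.sum_neg_distrib]
  refine Finset.sum_congr rfl fun l _ => ?_
  ring

/-- The closed formula solves the triangular system for the coefficients `c` in a basis whose
derivatives at an end point are `D`. -/
theorem entryFormula_eq {f : ℕ → ℝ} {c : Fin (n + 1) → ℝ}
    (hf : ∀ r : Fin (n + 1), f r = ∑ k, c k * D k r)
    (hzero : ∑ k, D k 0 = 1) (hsum : ∀ r : Fin (n + 1), r ≠ 0 → ∑ k, D k r = 0)
    (htri : ∀ k : Fin (n + 1), ∀ r < (k : ℕ), D k r = 0) (hdiag : ∀ k : Fin (n + 1), D k k ≠ 0)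
    (j : Fin (n + 1)) (hj : j ≠ 0) : entryFormula f D j = c j := by
  have hf0 : f 0 = c 0 := by
    have hz : ∀ k : Fin n, D k.succ 0 = 0 := fun k => htri _ _ (by simp)
    have h0 := hf 0
    rw [Fin.sum_univ_succ] at hzero h0
    simp only [hz, Finset.sum_const_zero, add_zero, Fin.val_zero, mul_zero] at hzero h0
    rw [h0, hzero, mul_one]
  -- Subtracting `c 0` times the zero sum of `D k j` removes the term `k = 0`; triangularity removes
  -- those with `k > j`.
  have hrec : ∀ j : Fin (n + 1), j ≠ 0 →
      f j = ∑ k ∈ Finset.Ioo 0 j, (c k - c 0) * D k j + (c j - c 0) * D j j := by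
    intro j hj
    have h1 : f j = ∑ k, (c k - c 0) * D k j := by
      simp_rw [sub_mul, Finset.sum_sub_distrib, ← Finset.mul_sum, hsum j hj, hf j]
      ring
    have h2 := Finset.sum_insert (s := Finset.Ioo 0 j) (a := j)
      (f := fun k => (c k - c 0) * D k j) (by simp)
    rw [h1, add_comm (∑ k ∈ _, _), ← h2]
    symm
    refine Finset.sum_subset (Finset.subset_univ _) fun k _ hk => ?_
    rw [Finset.mem_insert, Finset.mem_Ioo] at hk
    rcases eq_or_ne k 0 with rfl | hk0
    · simp
    · have : j < k := by
        by_contra! hkj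
        exact hk (hkj.eq_or_lt.imp id fun h => ⟨Fin.pos_of_ne_zero hk0, h⟩)
      rw [htri k j this, mul_zero]
  have key : ∀ j : Fin (n + 1), j ≠ 0 →
      c j - c 0 = (f j - ∑ r ∈ Finset.Ioo 0 j, f r / D r r * altChainSum D r j) / D j j := by
    intro j
    induction j using WellFoundedLT.induction with
    | ind j ih =>
      intro hj
      rw [eq_div_iff (hdiag j), eq_sub_iff_add_eq, hrec j hj, add_comm]
      congr 1
      have h2 : ∀ k ∈ Finset.Ioo 0 j, (c k - c 0) * D k j =
          f k / D k k * D k j -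
            ∑ r ∈ Finset.Ioo 0 k, f r / D r r * (altChainSum D r k / D k k * D k j) := by
        intro k hk
        rw [Finset.mem_Ioo] at hk
        rw [ih k hk.2 hk.1.ne', sub_div, sub_mul, Finset.sum_div, Finset.sum_mul]
        congr 1
        exact Finset.sum_congr rfl fun r _ => by ring
      rw [Finset.sum_congr rfl h2, Finset.sum_sub_distrib]
      -- Expanding the chain sums on the other side leaves the same double sum over `0 < r < k < j`,
      -- in the opposite order.
      have h3 : ∀ r : Fin (n + 1), f r / D r r * altChainSum D r j = f r / D r r * D r j -
          ∑ k ∈ Finset.Ioo r j, f r / D r r * (altChainSum D r k / D k k * D k j) := by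
        intro r
        rw [altChainSum_rec, mul_sub, Finset.mul_sum]
      simp_rw [h3, Finset.sum_sub_distrib]
      congr 1
      refine Finset.sum_comm' fun r k => ?_
      simp only [Finset.mem_Ioo]
      constructor
      · rintro ⟨⟨h, h'⟩, h4, h5⟩
        exact ⟨⟨h, h4⟩, h.trans h4, h5⟩
      · rintro ⟨⟨h, h'⟩, h4, h5⟩
        exact ⟨⟨h, h'.trans h5⟩, h', h5⟩
  have := key j hj
  simp only [entryFormula, altChainSum_eq]
  rw [sub_eq_iff_eq_add'] at this
  rw [this, hf0]
  ring

end Chains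

/-! ### Derivatives of linear combinations on the interval -/

section Derivatives

variable {n : ℕ} {α β : ℝ}

theorem dI_congr {f g : ℝ → ℝ} (h : EqOn f g (Icc α β)) (k : ℕ) {x : ℝ} (hx : x ∈ Icc α β) :
    dI α β k f x = dI α β k g x :=
  iteratedDerivWithin_congr h hx

theorem dI_linearCombination (hαβ : α < β) {b : Fin (n + 1) → ℝ → ℝ}
    (hb : ∀ j, ContDiffOn ℝ n (b j) (Icc α β)) (c : Fin (n + 1) → ℝ) {k : ℕ} (hk : k ≤ n)
    {x : ℝ} (hx : x ∈ Icc α β) :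
    dI α β k (fun u => ∑ j, c j * b j u) x = ∑ j, c j * dI α β k (b j) x := by
  have hs := uniqueDiffOn_Icc hαβ
  have hd : ∀ j, ContDiffWithinAt ℝ k (b j) (Icc α β) x := fun j =>
    (hb j x hx).of_le (by exact_mod_cast hk)
  have := iteratedDerivWithin_fun_sum (n := k) (I := Finset.univ) (f := fun j u => c j * b j u) hx hs
    fun j _ => contDiffWithinAt_const.mul (hd j)
  rw [dI, this]
  exact Finset.sum_congr rfl fun j _ => iteratedDerivWithin_const_mul hx hs (c j) (hd j)

theorem exists_coeff {b : Fin (n + 1) → ℝ → ℝ} {f : ℝ → ℝ}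
    (hf : (Icc α β).domRestrict f ∈ spanOn α β b) :
    ∃ c : Fin (n + 1) → ℝ, ∀ u ∈ Icc α β, f u = ∑ j, c j * b j u := by
  obtain ⟨c, hc⟩ := (Submodule.mem_span_range_iff_exists_fun ℝ).1 hf
  refine ⟨c, fun u hu => ?_⟩
  have := congrFun hc ⟨u, hu⟩
  simpa [Finset.sum_apply] using this.symm

theorem dI_eq_sum (hαβ : α < β) {b : Fin (n + 1) → ℝ → ℝ}
    (hb : ∀ j, ContDiffOn ℝ n (b j) (Icc α β)) {f : ℝ → ℝ} {c : Fin (n + 1) → ℝ}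
    (hf : ∀ u ∈ Icc α β, f u = ∑ j, c j * b j u) {k : ℕ} (hk : k ≤ n)
    {x : ℝ} (hx : x ∈ Icc α β) :
    dI α β k f x = ∑ j, c j * dI α β k (b j) x := by
  rw [dI_congr hf k hx, dI_linearCombination hαβ hb c hk hx]

theorem sum_dI_of_sum_eq_one (hαβ : α < β) {b : Fin (n + 1) → ℝ → ℝ}
    (hb : ∀ j, ContDiffOn ℝ n (b j) (Icc α β)) (h1 : ∀ u ∈ Icc α β, ∑ j, b j u = 1)
    {k : ℕ} (hk : k ≤ n) (hk0 : k ≠ 0) {x : ℝ} (hx : x ∈ Icc α β) :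
    ∑ j, dI α β k (b j) x = 0 := by
  have h := dI_eq_sum hαβ hb (f := fun _ => (1 : ℝ)) (c := 1)
    (fun u hu => by simp [h1 u hu]) hk hx
  simp only [Pi.one_apply, one_mul] at h
  rw [← h, dI, iteratedDerivWithin_const, if_neg hk0]

end Derivatives

/-! ### Coefficients with respect to the B-basis -/

section Coefficients

variable {n : ℕ} {α β : ℝ} {φ b : Fin (n + 1) → ℝ → ℝ}

theorem IsNormalizedBBasis.contDiffOn (hb : IsNormalizedBBasis n α β φ b)
    (hφ : IsECSystem n α β φ) (j : Fin (n + 1)) : ContDiffOn ℝ n (b j) (Icc α β) := by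
  have hmem : (Icc α β).domRestrict (b j) ∈ spanOn α β φ := by
    rw [← hb.span_eq]
    exact Submodule.subset_span ⟨j, rfl⟩
  obtain ⟨c, hc⟩ := exists_coeff hmem
  exact (ContDiffOn.sum fun i _ => contDiffOn_const.mul (hφ.contDiffOn i)).congr hc

theorem IsNormalizedBBasis.exists_coeff (hb : IsNormalizedBBasis n α β φ b) (i : Fin (n + 1)) :
    ∃ c : Fin (n + 1) → ℝ, ∀ u ∈ Icc α β, φ i u = ∑ j, c j * b j u := by
  refine ECCurve.exists_coeff ?_
  rw [hb.span_eq]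
  exact Submodule.subset_span ⟨i, rfl⟩

theorem IsNormalizedBBasis.coeff_eq_one (hb : IsNormalizedBBasis n α β φ b)
    {c : Fin (n + 1) → ℝ} (hc : ∀ u ∈ Icc α β, 1 = ∑ j, c j * b j u) (j : Fin (n + 1)) :
    c j = 1 := by
  -- Both `c` and the constant family 1 represent the function 1, so their difference represents 0.
  have h := Fintype.linearIndependent_iff.1 hb.linearIndependent (fun j => c j - 1) (by
    ext u
    simp [Finset.sum_apply, sub_mul, Finset.sum_sub_distrib, ← hc u u.2, hb.sum_eq_one u u.2]) j
  linarith

theorem IsNormalizedBBasis.coeff_zero (hb : IsNormalizedBBasis n α β φ b) (hαβ : α < β)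
    {f : ℝ → ℝ} {c : Fin (n + 1) → ℝ} (hc : ∀ u ∈ Icc α β, f u = ∑ j, c j * b j u) :
    c 0 = f α := by
  rw [hc α (left_mem_Icc.2 hαβ.le), Finset.sum_eq_single 0, hb.left_end, mul_one]
  · intro j _ hj
    have h := hb.left_zero j 0 (Fin.pos_of_ne_zero hj)
    rw [dI, iteratedDerivWithin_zero] at h
    rw [h, mul_zero]
  · simp

theorem IsNormalizedBBasis.coeff_last (hb : IsNormalizedBBasis n α β φ b) (hαβ : α < β)
    {f : ℝ → ℝ} {c : Fin (n + 1) → ℝ} (hc : ∀ u ∈ Icc α β, f u = ∑ j, c j * b j u) :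
    c (Fin.last n) = f β := by
  rw [hc β (right_mem_Icc.2 hαβ.le), Finset.sum_eq_single (Fin.last n), hb.right_end, mul_one]
  · intro j _ hj
    have h := hb.right_zero j 0 (Nat.sub_pos_of_lt (Fin.val_lt_last hj))
    rw [dI, iteratedDerivWithin_zero] at h
    rw [h, mul_zero]
  · simp

theorem IsNormalizedBBasis.leftEntry_eq (hb : IsNormalizedBBasis n α β φ b) (hαβ : α < β)
    (hφ : IsECSystem n α β φ) {i : Fin (n + 1)} {c : Fin (n + 1) → ℝ}
    (hc : ∀ u ∈ Icc α β, φ i u = ∑ j, c j * b j u) {j : Fin (n + 1)} (hj : j ≠ 0) :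
    leftEntry α β φ b i j = c j := by
  have hα := left_mem_Icc.2 hαβ.le
  have hcd := hb.contDiffOn hφ
  refine entryFormula_eq _ (fun r => dI_eq_sum hαβ hcd hc (Fin.is_le r) hα) ?_
    (fun r hr => sum_dI_of_sum_eq_one hαβ hcd hb.sum_eq_one (Fin.is_le r)
      (Fin.val_ne_zero_iff.2 hr) hα)
    hb.left_zero (fun k => (hb.left_pos k).ne') j hj
  simpa [dI] using hb.sum_eq_one α hα

/-- Under `k ↦ k.rev` the vanishing orders at `β` become those at `α`. The alternating sign in
`right_pos` is harmless, since the triangular system only needs a non-zero diagonal. -/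
theorem IsNormalizedBBasis.rightEntry_eq (hb : IsNormalizedBBasis n α β φ b) (hαβ : α < β)
    (hφ : IsECSystem n α β φ) {i : Fin (n + 1)} {c : Fin (n + 1) → ℝ}
    (hc : ∀ u ∈ Icc α β, φ i u = ∑ j, c j * b j u) {j : Fin (n + 1)} (hj : j ≠ 0) :
    rightEntry α β φ b i j = c j.rev := by
  have hβ := right_mem_Icc.2 hαβ.le
  have hcd := hb.contDiffOn hφ
  have hval : ∀ k : Fin (n + 1), n - (k.rev : ℕ) = k := fun k => by
    rw [Fin.val_rev]
    omega
  refine entryFormula_eq (c := fun k => c k.rev) _ (fun r => ?_) ?_ (fun r hr => ?_)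
    (fun k r hr => hb.right_zero k.rev r (by rwa [hval])) (fun k => ?_) j hj
  · rw [dI_eq_sum hαβ hcd hc (Fin.is_le r) hβ]
    exact (Equiv.sum_comp Fin.revPerm fun k => c k * dI α β r (b k) β).symm
  · rw [← hb.sum_eq_one β hβ]
    simpa [dI] using Equiv.sum_comp Fin.revPerm fun k => b k β
  · rw [← sum_dI_of_sum_eq_one hαβ hcd hb.sum_eq_one (Fin.is_le r) (Fin.val_ne_zero_iff.2 hr) hβ]
    exact Equiv.sum_comp Fin.revPerm fun k => dI α β r (b k) β
  · have h := (hb.right_pos k.rev).ne'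
    rw [hval] at h
    exact right_ne_zero_of_mul h

/-- The entries of the transformation matrix are the coefficients of the ordinary basis
functions in the B-basis. -/
theorem IsNormalizedBBasis.t_eq (hb : IsNormalizedBBasis n α β φ b) (hαβ : α < β)
    (hφ : IsECSystem n α β φ) (hφ0 : ∀ u ∈ Icc α β, φ 0 u = 1)
    {i : Fin (n + 1)} {c : Fin (n + 1) → ℝ}
    (hc : ∀ u ∈ Icc α β, φ i u = ∑ j, c j * b j u) (j : Fin (n + 1)) :
    t α β φ b i j = c j := by
  unfold t
  split_ifs with hi hj hj' hj''
  · subst hi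
    exact (hb.coeff_eq_one (fun u hu => (hφ0 u hu).symm.trans (hc u hu)) j).symm
  · rw [hj, hb.coeff_zero hαβ hc]
  · rw [hj', hb.coeff_last hαβ hc]
  · exact hb.leftEntry_eq hαβ hφ hc hj
  · rw [hb.rightEntry_eq hαβ hφ hc, Fin.rev_rev]
    rintro h
    exact hj' (by rw [← Fin.rev_rev j, h, Fin.rev_zero])

end Coefficients

end ECCurve

theorem theorem2 (n : ℕ) (hn : 1 ≤ n) (α β : ℝ) (hαβ : α < β)
    (φ : Fin (n + 1) → ℝ → ℝ) (hφ : ECCurve.IsECSystem n α β φ)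
    (hφ0 : ∀ u ∈ Set.Icc α β, φ 0 u = 1)
    (b : Fin (n + 1) → ℝ → ℝ) (hb : ECCurve.IsNormalizedBBasis n α β φ b)
    (δ : ℕ) (hδ : 2 ≤ δ) (lam : Fin (n + 1) → EuclideanSpace ℝ (Fin δ)) :
    (∃ p : Fin (n + 1) → EuclideanSpace ℝ (Fin δ),
      (∀ j l, p j l = ∑ i, lam i l * ECCurve.t α β φ b i j) ∧
      ∀ u ∈ Set.Icc α β, ∑ i, φ i u • lam i = ∑ j, b j u • p j) ∧
    (∀ i j : Fin (n + 1), i ≠ 0 → 2 * (j : ℕ) = n →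
      ECCurve.leftEntry α β φ b i j = ECCurve.rightEntry α β φ b i j) := by
  have hex : ∀ i, ∀ u ∈ Set.Icc α β, φ i u = ∑ j, ECCurve.t α β φ b i j * b j u := by
    intro i u hu
    obtain ⟨c, hc⟩ := hb.exists_coeff i
    rw [hc u hu]
    exact Finset.sum_congr rfl fun j _ => by rw [hb.t_eq hαβ hφ hφ0 hc]
  refine ⟨⟨fun j => ∑ i, ECCurve.t α β φ b i j • lam i, fun j l => ?_, fun u hu => ?_⟩,
    fun i j _ hj => ?_⟩
  · simp [mul_comm]
  · simp_rw [Finset.smul_sum, smul_smul]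
    rw [Finset.sum_comm]
    refine Finset.sum_congr rfl fun i _ => ?_
    rw [hex i u hu, Finset.sum_smul]
    exact Finset.sum_congr rfl fun j _ => by rw [mul_comm]
  · obtain ⟨c, hc⟩ := hb.exists_coeff i
    have hj0 : j ≠ 0 := by
      -- Column 0 would be the middle one only for `n = 0`, which `hn` excludes.
      rintro rfl
      simp at hj
      omega
    rw [hb.leftEntry_eq hαβ hφ hc hj0, hb.rightEntry_eq hαβ hφ hc hj0]
    -- Both entries are coefficients of `φ i`, at `j` and at `j.rev`, and `n - j = j` in the middle
    -- column.
    congr 1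
    ext
    rw [Fin.val_rev]
    omega
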